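/- Let $Q$ be a finite quiver with vertex set $Q_0$, arrow set $Q_1$ and source and target maps $s,t:Q_1\to Q_0$. Let $M=(M_\alpha)_{\alpha\in Q_1}$ be a finite-dimensional complex representation of $Q$ with dimension vector $\mathbf{d}=(d_i)_{i\in Q_0}$, where $M_\alpha:\mathbb{C}^{d_{s(\alpha)}}\to\mathbb{C}^{d_{t(\alpha)}}$, and let $\mathbf{e}=(e_i)_{i\in Q_0}$ be a vector of non-negative integers. Let $\mathrm{Gr}_{\mathbf e}(M)$ be the quiver Grassmannian, i.e. the closed subscheme of $\prod_{i\in Q_0}\mathrm{Gr}_{e_i}(\mathbb{C}^{d_i})$ over $\mathbb{C}$ defined by the incidence conditions $M_\alpha(N_{s(\alpha)})\subseteq N_{t(\alpha)}$, $\alpha\in Q_1$, on the families of subspaces $N_i\subseteq\mathbb{C}^{d_i}$ with $\dim N_i=e_i$. Suppose that $M$ is rigid, that is, $\operatorname{Ext}^1(M,M)=0$ in the category of finite-dimensional complex representations of $Q$, and that $\mathrm{Gr}_{\mathbf e}(M)$ is non-empty. Then the integer $$\langle\mathbf e,\mathbf d-\mathbf e\rangle=\sum_{i\in Q_0}e_i(d_i-e_i)-\sum_{\alpha\in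 Q_1}e_{s(\alpha)}\,(d_{t(\alpha)}-e_{t(\alpha)})$$ is non-negative, and $\mathrm{Gr}_{\mathbf e}(M)$ is smooth over $\mathbb{C}$ of relative dimension $\langle\mathbf e,\mathbf d-\mathbf e\rangle$; in particular, its (Krull) dimension is $\langle\mathbf e,\mathbf d-\mathbf e\rangle$. -/

import Mathlib

open CategoryTheory CategoryTheory.Limits AlgebraicGeometry

noncomputable section

namespace QuiverGr

/-! ### Quiver representations over the complex numbers

A finite quiver is a finite type `V` of vertices with finite types `i ⟶ j` of arrows
(loops, multiple arrows and oriented cycles are allowed). -/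

/-- The category `Rep(Q)` of finite-dimensional complex representations of a quiver:
functors from the free category on the quiver to finite-dimensional vector spaces. -/
abbrev Rep (V : Type) [Quiver.{0} V] := Paths V ⥤ FGModuleCat.{0} ℂ

/-- The variety `R_d` of representations with dimension vector `d`: one `d j × d i` matrix
for every arrow `i ⟶ j`. -/
abbrev RepSpace {V : Type} [Quiver.{0} V] (d : V → ℕ) : Type :=
  ∀ ⦃i j : V⦄, (i ⟶ j) → Matrix (Fin (d j)) (Fin (d i)) ℂ

/-- The object of `Rep(Q)` given by a point of `R_d`: the space `ℂ ^ (d i)` at the vertex `i`,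
and multiplication by the matrix `M a` along the arrow `a`. -/
def toRep {V : Type} [Quiver.{0} V] {d : V → ℕ} (M : RepSpace d) : Rep V :=
  Paths.lift
    { obj := fun i => FGModuleCat.of ℂ (Fin (d i) → ℂ)
      map := fun a => FGModuleCat.ofHom (Matrix.toLin' (M a)) }

/-- `M` is rigid: `Ext¹(M, M) = 0` in the abelian category `Rep(Q)`. -/
def IsRigid {V : Type} [Quiver.{0} V] {d : V → ℕ} (M : RepSpace d) : Prop :=
  haveI : HasExt (Rep V) := HasExt.standard (Rep V)
  Subsingleton (Abelian.Ext (toRep M) (toRep M) 1)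

/-- The Euler form `⟨x, y⟩ = ∑ i, x i * y i - ∑ (a : i ⟶ j), x i * y j` of a finite quiver. -/
def eulerForm {V : Type} [Quiver.{0} V] [Fintype V] [∀ i j : V, Fintype (i ⟶ j)]
    (x y : V → ℤ) : ℤ :=
  ∑ i, x i * y i - ∑ i, ∑ j, ∑ _a : i ⟶ j, x i * y j

/-! ### The standard charts of the quiver Grassmannian

The quiver Grassmannian `Gr_e(M)` is the closed subscheme of `∏ i, Gr (e i) (ℂ ^ (d i))` given by
the incidence conditions `M a (N i) ⊆ N j`. It is constructed by gluing its intersections with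
the standard affine charts of the product of Grassmannians. A chart is indexed by a family
`J` of subsets `J i ⊆ {1, …, d i}` with `e i` elements; in it, `N i` is the column span of a unique
`d i × e i` matrix `F i` whose rows with index in `J i` form the identity matrix. -/

/-- Families of `d i × e i` matrices over `A`. -/
abbrev Frames {V : Type} (d e : V → ℕ) (A : Type) : Type :=
  ∀ i, Matrix (Fin (d i)) (Fin (e i)) A

/-- The charts: `J i` is (the increasing enumeration of) an `e i`-element subset of the rows. -/
abbrev ChartIndex {V : Type} (d e : V → ℕ) : Type := ∀ i, Fin (e i) ↪o Fin (d i)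

/-- The square matrix formed by the rows of `F i` with index in `J i`. -/
def block {V : Type} {d e : V → ℕ} {A : Type} (J : ChartIndex d e) (F : Frames d e A) (i : V) :
    Matrix (Fin (e i)) (Fin (e i)) A :=
  (F i).submatrix (J i) id

/-- The matrix of the arrow `a`, over a ring `A` with a ring homomorphism `φ : ℂ →+* A`. -/
def arrowMat {V : Type} [Quiver.{0} V] {d : V → ℕ} (M : RepSpace d) {A : Type} [CommRing A]
    (φ : ℂ →+* A) {i j : V} (a : i ⟶ j) : Matrix (Fin (d j)) (Fin (d i)) A :=
  (M a).map φ

/-- The `A`-valued points of the chart `J` of the quiver Grassmannian. In the presence of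
`block J F j = 1`, the columns of `M a * F i` lie in the column span of `F j` if and only if
the equation `stable` holds, since the coefficients have to be the rows of `M a * F i` with
index in `J j`. -/
structure IsChartPoint {V : Type} [Quiver.{0} V] {d e : V → ℕ} (M : RepSpace d)
    (J : ChartIndex d e) {A : Type} [CommRing A] (φ : ℂ →+* A) (F : Frames d e A) : Prop where
  normalized : ∀ i, block J F i = 1
  stable : ∀ ⦃i j : V⦄ (a : i ⟶ j),
    arrowMat M φ a * F i = F j * (arrowMat M φ a * F i).submatrix (J j) id

section Chart

set_option linter.unusedSectionVars false

variable {V : Type} [Quiver.{0} V] {d : V → ℕ} (e : V → ℕ) (M : RepSpace d)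

/-- The indices of the matrix entries of a family of `d i × e i` matrices. -/
abbrev Entry {V : Type} (d e : V → ℕ) : Type := Σ i, Fin (d i) × Fin (e i)

/-- The polynomial ring in all matrix entries. -/
abbrev EntryRing {V : Type} (d e : V → ℕ) : Type := MvPolynomial (Entry d e) ℂ

/-- The inclusion of the scalars into the polynomial ring. -/
abbrev polyScalar {V : Type} (d e : V → ℕ) : ℂ →+* EntryRing d e := MvPolynomial.C

/-- The generic family of matrices. -/
def genericFrame {V : Type} (d e : V → ℕ) : Frames d e (EntryRing d e) :=
  fun i => Matrix.of fun p q => MvPolynomial.X ⟨i, p, q⟩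

variable {e}

/-- The equations of a chart: those of `IsChartPoint`, entry by entry. -/
def chartIdeal (J : ChartIndex d e) : Ideal (EntryRing d e) :=
  Ideal.span
    ({x | ∃ i p q, x = block J (genericFrame d e) i p q -
        (1 : Matrix (Fin (e i)) (Fin (e i)) (EntryRing d e)) p q} ∪
     {x | ∃ (i j : V) (a : i ⟶ j) (p : Fin (d j)) (q : Fin (e i)),
        x = (arrowMat M (polyScalar d e) a * genericFrame d e i) p q
          - (genericFrame d e j *
            (arrowMat M (polyScalar d e) a * genericFrame d e i).submatrix (J j) id) p q})

/-- The coordinate ring of a chart. -/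
abbrev ChartRing (J : ChartIndex d e) : Type := EntryRing d e ⧸ chartIdeal M J

/-- The structure map of the coordinate ring. -/
def chartScalar (J : ChartIndex d e) : ℂ →+* ChartRing M J :=
  (Ideal.Quotient.mk (chartIdeal M J)).comp MvPolynomial.C

/-- The universal point of a chart. -/
def chartFrame (J : ChartIndex d e) : Frames d e (ChartRing M J) :=
  fun i => (genericFrame d e i).map (Ideal.Quotient.mk (chartIdeal M J))

/-- A family of matrices pushed forward along a ring homomorphism. -/
def mapFrame {V : Type} {d e : V → ℕ} {A B : Type} [CommRing A] [CommRing B] (f : A →+* B)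
    (F : Frames d e A) : Frames d e B :=
  fun i => (F i).map f

lemma block_mapFrame {A B : Type} [CommRing A] [CommRing B] (f : A →+* B) (J : ChartIndex d e)
    (F : Frames d e A) (i : V) : block J (mapFrame f F) i = (block J F i).map f := rfl

lemma arrowMat_comp {A B : Type} [CommRing A] [CommRing B] (f : A →+* B) (φ : ℂ →+* A)
    {i j : V} (a : i ⟶ j) : arrowMat M (f.comp φ) a = (arrowMat M φ a).map f := by
  ext; rfl

variable {M}

lemma IsChartPoint.map {J : ChartIndex d e} {A B : Type} [CommRing A] [CommRing B]
    {φ : ℂ →+* A} {F : Frames d e A} (h : IsChartPoint M J φ F) (f : A →+* B) :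
    IsChartPoint M J (f.comp φ) (mapFrame f F) where
  normalized i := by
    rw [block_mapFrame, h.normalized i, Matrix.map_one f f.map_zero f.map_one]
  stable i j a := by
    have := congrArg (fun N => N.map f) (h.stable a)
    simp only [Matrix.map_mul] at this
    rw [arrowMat_comp]
    simp only [mapFrame]
    refine this.trans ?_
    have h2 : (arrowMat M φ a).map f * (F i).map f = (arrowMat M φ a * F i).map f :=
      Matrix.map_mul.symm
    rw [h2]
    rfl

variable (M)

lemma chartFrame_isChartPoint (J : ChartIndex d e) :
    IsChartPoint M J (chartScalar M J) (chartFrame M J) where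
  normalized i := by
    ext p q
    have h : block J (genericFrame d e) i p q -
        (1 : Matrix (Fin (e i)) (Fin (e i)) (EntryRing d e)) p q ∈ chartIdeal M J :=
      Ideal.subset_span (Or.inl ⟨i, p, q, rfl⟩)
    have h2 := Ideal.Quotient.eq_zero_iff_mem.mpr h
    rw [map_sub, sub_eq_zero] at h2
    have h3 : Ideal.Quotient.mk (chartIdeal M J) ((1 : Matrix (Fin (e i)) (Fin (e i)) _) p q)
        = (1 : Matrix (Fin (e i)) (Fin (e i)) _) p q := by
      by_cases hpq : p = q
      · subst hpq; simp
      · simp [Matrix.one_apply_ne hpq]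
    exact h2.trans h3
  stable i j a := by
    ext p q
    have h : (arrowMat M (polyScalar d e) a * genericFrame d e i) p q
          - (genericFrame d e j *
            (arrowMat M (polyScalar d e) a * genericFrame d e i).submatrix (J j) id) p q
        ∈ chartIdeal M J :=
      Ideal.subset_span (Or.inr ⟨i, j, a, p, q, rfl⟩)
    have h2 := Ideal.Quotient.eq_zero_iff_mem.mpr h
    rw [map_sub, sub_eq_zero] at h2
    simp only [Matrix.mul_apply, map_sum, map_mul, Matrix.submatrix_apply, id] at h2 ⊢
    exact h2

/-- The ring homomorphism out of the coordinate ring of a chart given by a point. -/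
def chartLift (J : ChartIndex d e) {A : Type} [CommRing A] (φ : ℂ →+* A) (F : Frames d e A)
    (h : IsChartPoint M J φ F) : ChartRing M J →+* A :=
  Ideal.Quotient.lift (chartIdeal M J) (MvPolynomial.eval₂Hom φ fun x => F x.1 x.2.1 x.2.2) (by
    have hgen : mapFrame (MvPolynomial.eval₂Hom φ fun x => F x.1 x.2.1 x.2.2)
        (genericFrame d e) = F := by
      funext i; ext p q; simp [mapFrame, genericFrame]
    have hC : (MvPolynomial.eval₂Hom φ fun x : Entry d e => F x.1 x.2.1 x.2.2).comp
        MvPolynomial.C = φ := by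
      ext; simp
    generalize (MvPolynomial.eval₂Hom φ fun x : Entry d e => F x.1 x.2.1 x.2.2) = g at hgen hC
    subst hgen hC
    intro x hx
    rw [← RingHom.mem_ker]
    refine Ideal.span_le.mpr ?_ hx
    rintro y (⟨i, p, q, rfl⟩ | ⟨i, j, a, p, q, rfl⟩)
    · have := congrFun (congrFun (h.normalized i) p) q
      rw [block_mapFrame, Matrix.map_apply] at this
      rw [SetLike.mem_coe, RingHom.mem_ker, map_sub, sub_eq_zero, this]
      by_cases hpq : p = q
      · subst hpq; simp
      · simp [Matrix.one_apply_ne hpq]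
    · have := congrFun (congrFun (h.stable a) p) q
      rw [SetLike.mem_coe, RingHom.mem_ker, map_sub, sub_eq_zero]
      rw [arrowMat_comp] at this
      simp only [Matrix.mul_apply, map_sum, map_mul, Matrix.submatrix_apply, id] at this ⊢
      exact this)

lemma chartLift_comp (J : ChartIndex d e) {A : Type} [CommRing A] (φ : ℂ →+* A)
    (F : Frames d e A) (h : IsChartPoint M J φ F) :
    (chartLift M J φ F h).comp (chartScalar M J) = φ := by
  ext x
  simp [chartLift, chartScalar]

lemma chartLift_frame (J : ChartIndex d e) {A : Type} [CommRing A] (φ : ℂ →+* A)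
    (F : Frames d e A) (h : IsChartPoint M J φ F) :
    mapFrame (chartLift M J φ F h) (chartFrame M J) = F := by
  funext i; ext p q
  simp [mapFrame, chartFrame, chartLift, genericFrame]

lemma chartRing_hom_ext {J : ChartIndex d e} {A : Type} [CommRing A] {f g : ChartRing M J →+* A}
    (h1 : f.comp (chartScalar M J) = g.comp (chartScalar M J))
    (h2 : mapFrame f (chartFrame M J) = mapFrame g (chartFrame M J)) : f = g := by
  apply Ideal.Quotient.ringHom_ext
  apply MvPolynomial.ringHom_ext
  · intro r
    exact congrArg (fun t : ℂ →+* A => t r) h1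
  · rintro ⟨i, p, q⟩
    exact congrFun (congrFun (congrFun h2 i) p) q

/-! ### Change of charts -/

/-- Two families of matrices with the same column spans, through an invertible change of basis. -/
def SameSpan {V : Type} {d e : V → ℕ} {A : Type} [CommRing A] (F G : Frames d e A) : Prop :=
  ∃ g : ∀ i, (Matrix (Fin (e i)) (Fin (e i)) A)ˣ, ∀ i, F i = G i * (g i).val

lemma SameSpan.symm {A : Type} [CommRing A] {F G : Frames d e A} (h : SameSpan F G) :
    SameSpan G F := by
  obtain ⟨g, hg⟩ := h
  exact ⟨fun i => (g i)⁻¹, fun i => by rw [hg i, Matrix.mul_assoc, Units.mul_inv, Matrix.mul_one]⟩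

lemma SameSpan.trans {A : Type} [CommRing A] {F G H : Frames d e A} (h : SameSpan F G)
    (h' : SameSpan G H) : SameSpan F H := by
  obtain ⟨g, hg⟩ := h
  obtain ⟨g', hg'⟩ := h'
  exact ⟨fun i => g' i * g i, fun i => by rw [hg i, hg' i, Matrix.mul_assoc, Units.val_mul]⟩

lemma SameSpan.map {A B : Type} [CommRing A] [CommRing B] (f : A →+* B) {F G : Frames d e A}
    (h : SameSpan F G) : SameSpan (mapFrame f F) (mapFrame f G) := by
  obtain ⟨g, hg⟩ := h
  refine ⟨fun i => Units.map (f.mapMatrix : Matrix (Fin (e i)) (Fin (e i)) A →+* _).toMonoidHom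
    (g i), fun i => ?_⟩
  simp only [mapFrame, hg i, Matrix.map_mul]
  rfl

lemma block_mul {A : Type} [CommRing A] (J : ChartIndex d e) {F G : Frames d e A} {i : V}
    {g : Matrix (Fin (e i)) (Fin (e i)) A} (h : F i = G i * g) :
    block J F i = block J G i * g := by
  unfold block
  rw [h]
  rfl

lemma SameSpan.eq_of_normalized {A : Type} [CommRing A] {F G : Frames d e A} (h : SameSpan F G)
    (J : ChartIndex d e) (hF : ∀ i, block J F i = 1) (hG : ∀ i, block J G i = 1) : F = G := by
  obtain ⟨g, hg⟩ := h
  funext i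
  have := block_mul J (hg i)
  rw [hF, hG, Matrix.one_mul] at this
  rw [hg i, ← this, Matrix.mul_one]

lemma isUnit_block {A : Type} [CommRing A] {F G : Frames d e A} (h : SameSpan F G)
    (J : ChartIndex d e) (hG : ∀ i, IsUnit (block J G i).det) (i : V) :
    IsUnit (block J F i).det := by
  obtain ⟨g, hg⟩ := h
  rw [block_mul J (hg i), Matrix.det_mul]
  exact (hG i).mul ((Matrix.isUnit_iff_isUnit_det _).mp (g i).isUnit)

lemma isUnit_block_map {A B : Type} [CommRing A] [CommRing B] (f : A →+* B) {F : Frames d e A}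
    (J : ChartIndex d e) (hF : ∀ i, IsUnit (block J F i).det) (i : V) :
    IsUnit (block J (mapFrame f F) i).det := by
  have := (hF i).map f
  rwa [RingHom.map_det] at this

/-- The family `F i * (block K F i)⁻¹`, which has the same column spans as `F` and is normalized
with respect to `K`. -/
def normalize {V : Type} {d e : V → ℕ} {A : Type} [CommRing A] (K : ChartIndex d e)
    (F : Frames d e A) : Frames d e A :=
  fun i => F i * (block K F i)⁻¹

lemma normalize_sameSpan {A : Type} [CommRing A] (K : ChartIndex d e) (F : Frames d e A)
    (hK : ∀ i, IsUnit (block K F i).det) : SameSpan (normalize K F) F :=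
  ⟨fun i => ((Matrix.isUnit_iff_isUnit_det _).mpr
      ((Matrix.isUnit_nonsing_inv_det (block K F i) (hK i)))).unit, fun _ => rfl⟩

variable {M}

lemma IsChartPoint.normalize {J : ChartIndex d e} {A : Type} [CommRing A] {φ : ℂ →+* A}
    {F : Frames d e A} (h : IsChartPoint M J φ F) (K : ChartIndex d e)
    (hK : ∀ i, IsUnit (block K F i).det) : IsChartPoint M K φ (normalize K F) := by
  have h1 : ∀ i, block K (QuiverGr.normalize K F) i = 1 := fun i => by
    rw [block_mul K (F := QuiverGr.normalize K F) (G := F) (g := (block K F i)⁻¹) rfl]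
    exact Matrix.mul_nonsing_inv _ (hK i)
  refine ⟨h1, fun i j a => ?_⟩
  obtain ⟨L, hL⟩ : ∃ L : Matrix (Fin (e j)) (Fin (e i)) A, arrowMat M φ a * QuiverGr.normalize K F i
      = QuiverGr.normalize K F j * L := by
    refine ⟨block K F j * (arrowMat M φ a * F i).submatrix (J j) id * (block K F i)⁻¹, ?_⟩
    unfold QuiverGr.normalize
    rw [← Matrix.mul_assoc, ← Matrix.mul_assoc, ← Matrix.mul_assoc, Matrix.mul_assoc (F j),
      Matrix.nonsing_inv_mul _ (hK j), Matrix.mul_one, ← h.stable a]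
  have h2 : (arrowMat M φ a * QuiverGr.normalize K F i).submatrix (K j) id = L := by
    have h3 : (QuiverGr.normalize K F j * L).submatrix (K j) id
        = block K (QuiverGr.normalize K F) j * L := rfl
    rw [hL, h3, h1, Matrix.one_mul]
  rw [h2, hL]

variable (M)

/-! ### Morphisms into the charts and their overlaps -/

/-- A chart of the quiver Grassmannian. -/
abbrev chart (J : ChartIndex d e) : Scheme.{0} := Spec (CommRingCat.of (ChartRing M J))

/-- The scalars of a scheme over a chart. -/
def scalarOf {J : ChartIndex d e} {T : Scheme.{0}} (f : T ⟶ chart M J) : ℂ →+* Γ(T, ⊤) :=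
  (f.appTop.hom.comp (Scheme.ΓSpecIso (CommRingCat.of (ChartRing M J))).inv.hom).comp
    (chartScalar M J)

/-- The family of matrices of global functions that corresponds to a morphism to a chart. -/
def frameOf {J : ChartIndex d e} {T : Scheme.{0}} (f : T ⟶ chart M J) : Frames d e Γ(T, ⊤) :=
  mapFrame (f.appTop.hom.comp (Scheme.ΓSpecIso (CommRingCat.of (ChartRing M J))).inv.hom)
    (chartFrame M J)

lemma isChartPoint_of {J : ChartIndex d e} {T : Scheme.{0}} (f : T ⟶ chart M J) :
    IsChartPoint M J (scalarOf M f) (frameOf M f) :=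
  (chartFrame_isChartPoint M J).map _

lemma scalarOf_comp {J : ChartIndex d e} {S T : Scheme.{0}} (g : S ⟶ T) (f : T ⟶ chart M J) :
    scalarOf M (g ≫ f) = g.appTop.hom.comp (scalarOf M f) := by
  simp only [scalarOf, Scheme.Hom.comp_appTop, CommRingCat.hom_comp]
  rfl

lemma frameOf_comp {J : ChartIndex d e} {S T : Scheme.{0}} (g : S ⟶ T) (f : T ⟶ chart M J) :
    frameOf M (g ≫ f) = mapFrame g.appTop.hom (frameOf M f) := by
  simp only [frameOf, Scheme.Hom.comp_appTop, CommRingCat.hom_comp]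
  rfl

lemma chart_hom_ext {J : ChartIndex d e} {T : Scheme.{0}} {f g : T ⟶ chart M J}
    (h1 : scalarOf M f = scalarOf M g) (h2 : SameSpan (frameOf M f) (frameOf M g)) : f = g := by
  apply ext_to_Spec
  ext1
  exact chartRing_hom_ext M h1
    (h2.eq_of_normalized J (isChartPoint_of M f).normalized (isChartPoint_of M g).normalized)

/-- The function on the chart `J` whose non-vanishing describes the intersection with the
chart `K`. -/
def overlapDet [Fintype V] (J K : ChartIndex d e) : ChartRing M J :=
  ∏ i, (block K (chartFrame M J) i).det

/-- The intersection of the charts `J` and `K`, as an open subscheme of the chart `J`. -/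
abbrev overlap [Fintype V] (J K : ChartIndex d e) : Scheme.{0} :=
  Spec (CommRingCat.of (Localization.Away (overlapDet M J K)))

/-- The inclusion of the intersection of the charts `J` and `K` into the chart `J`. -/
def overlapι [Fintype V] (J K : ChartIndex d e) : overlap M J K ⟶ chart M J :=
  Spec.map (CommRingCat.ofHom (algebraMap (ChartRing M J) (Localization.Away (overlapDet M J K))))

instance [Fintype V] (J K : ChartIndex d e) : IsOpenImmersion (overlapι M J K) :=
  IsOpenImmersion.of_isLocalization (overlapDet M J K)


/-- The morphism to a chart given by a point with values in the global functions. -/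
def chartMk (J : ChartIndex d e) {T : Scheme.{0}} (φ : ℂ →+* Γ(T, ⊤)) (F : Frames d e Γ(T, ⊤))
    (h : IsChartPoint M J φ F) : T ⟶ chart M J :=
  T.toSpecΓ ≫ Spec.map (CommRingCat.ofHom (chartLift M J φ F h))

lemma toSpecΓ_map_ring {T : Scheme.{0}} {R : Type} [CommRing R] (g : R →+* Γ(T, ⊤)) :
    (T.toSpecΓ ≫ Spec.map (CommRingCat.ofHom g)).appTop.hom.comp
      (Scheme.ΓSpecIso (CommRingCat.of R)).inv.hom = g := by
  have h : (Scheme.ΓSpecIso (CommRingCat.of R)).inv ≫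
      (T.toSpecΓ ≫ Spec.map (CommRingCat.ofHom g)).appTop = CommRingCat.ofHom g := by
    rw [Scheme.Hom.comp_appTop, Scheme.toSpecΓ_appTop, ← Scheme.ΓSpecIso_inv_naturality_assoc]
    simp
  exact congrArg CommRingCat.Hom.hom h

lemma scalarOf_chartMk (J : ChartIndex d e) {T : Scheme.{0}} (φ : ℂ →+* Γ(T, ⊤))
    (F : Frames d e Γ(T, ⊤)) (h : IsChartPoint M J φ F) : scalarOf M (chartMk M J φ F h) = φ := by
  unfold scalarOf chartMk
  rw [toSpecΓ_map_ring, chartLift_comp]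

lemma frameOf_chartMk (J : ChartIndex d e) {T : Scheme.{0}} (φ : ℂ →+* Γ(T, ⊤))
    (F : Frames d e Γ(T, ⊤)) (h : IsChartPoint M J φ F) : frameOf M (chartMk M J φ F h) = F := by
  unfold frameOf chartMk
  rw [toSpecΓ_map_ring, chartLift_frame]

variable [Fintype V]

lemma isUnit_overlapDet (J K : ChartIndex d e) {A : Type} [CommRing A] (f : ChartRing M J →+* A)
    (hK : ∀ i, IsUnit (block K (mapFrame f (chartFrame M J)) i).det) :
    IsUnit (f (overlapDet M J K)) := by
  unfold overlapDet
  rw [map_prod]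
  refine (IsUnit.prod_univ_iff).mpr fun i => ?_
  have := hK i
  rw [block_mapFrame] at this
  rwa [RingHom.map_det]

/-- The morphism to the intersection of the charts `J` and `K` given by a point of `J`. -/
def overlapMk (J K : ChartIndex d e) {T : Scheme.{0}} (φ : ℂ →+* Γ(T, ⊤))
    (F : Frames d e Γ(T, ⊤)) (h : IsChartPoint M J φ F) (hK : ∀ i, IsUnit (block K F i).det) :
    T ⟶ overlap M J K :=
  T.toSpecΓ ≫ Spec.map (CommRingCat.ofHom
    (IsLocalization.Away.lift (S := Localization.Away (overlapDet M J K)) (overlapDet M J K)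
      (g := chartLift M J φ F h)
      (isUnit_overlapDet M J K _ (by rwa [chartLift_frame]))))

lemma overlapMk_ι (J K : ChartIndex d e) {T : Scheme.{0}} (φ : ℂ →+* Γ(T, ⊤))
    (F : Frames d e Γ(T, ⊤)) (h : IsChartPoint M J φ F) (hK : ∀ i, IsUnit (block K F i).det) :
    overlapMk M J K φ F h hK ≫ overlapι M J K = chartMk M J φ F h := by
  unfold overlapMk overlapι chartMk
  rw [Category.assoc, ← Spec.map_comp, ← CommRingCat.ofHom_comp, IsLocalization.Away.lift_comp]

lemma isUnit_of_overlap {J K : ChartIndex d e} {T : Scheme.{0}} (f : T ⟶ overlap M J K) (i : V) :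
    IsUnit (block K (frameOf M (f ≫ overlapι M J K)) i).det := by
  have h : IsUnit (algebraMap (ChartRing M J) (Localization.Away (overlapDet M J K))
      (overlapDet M J K)) := IsLocalization.Away.algebraMap_isUnit _
  have h0 : algebraMap (ChartRing M J) (Localization.Away (overlapDet M J K)) (overlapDet M J K)
      = ∏ i, algebraMap (ChartRing M J) (Localization.Away (overlapDet M J K))
          (block K (chartFrame M J) i).det := map_prod _ _ _
  rw [h0, IsUnit.prod_univ_iff] at h
  have h1 := h i
  rw [RingHom.map_det] at h1
  have h2 := h1.map (f.appTop.hom.comp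
    (Scheme.ΓSpecIso (CommRingCat.of (Localization.Away (overlapDet M J K)))).inv.hom)
  rw [RingHom.map_det] at h2
  have h3 : ((overlapι M J K).appTop.hom.comp
        (Scheme.ΓSpecIso (CommRingCat.of (ChartRing M J))).inv.hom) =
      (Scheme.ΓSpecIso (CommRingCat.of (Localization.Away (overlapDet M J K)))).inv.hom.comp
        (algebraMap (ChartRing M J) (Localization.Away (overlapDet M J K))) := by
    have := Scheme.ΓSpecIso_inv_naturality (CommRingCat.ofHom
      (algebraMap (ChartRing M J) (Localization.Away (overlapDet M J K))))
    exact (congrArg CommRingCat.Hom.hom this).symm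
  have h4 : frameOf M (f ≫ overlapι M J K) = mapFrame (f.appTop.hom.comp
      ((Scheme.ΓSpecIso (CommRingCat.of (Localization.Away (overlapDet M J K)))).inv.hom.comp
        (algebraMap (ChartRing M J) (Localization.Away (overlapDet M J K))))) (chartFrame M J) := by
    rw [frameOf_comp, ← h3]
    rfl
  rw [h4]
  exact h2

/-- The change of charts from `J` to `K`, on the intersection of the two charts. -/
def transition (J K : ChartIndex d e) : overlap M J K ⟶ overlap M K J :=
  overlapMk M K J (scalarOf M (𝟙 (overlap M J K) ≫ overlapι M J K))
    (normalize K (frameOf M (𝟙 (overlap M J K) ≫ overlapι M J K)))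
    ((isChartPoint_of M _).normalize K (isUnit_of_overlap M _))
    (isUnit_block (normalize_sameSpan K _ (isUnit_of_overlap M _)) J fun i => by
      rw [(isChartPoint_of M _).normalized i]; simp)

lemma scalarOf_transition {J K : ChartIndex d e} {T : Scheme.{0}} (f : T ⟶ overlap M J K) :
    scalarOf M (f ≫ transition M J K ≫ overlapι M K J) = scalarOf M (f ≫ overlapι M J K) := by
  unfold transition
  rw [overlapMk_ι, scalarOf_comp, scalarOf_chartMk, ← scalarOf_comp, Category.id_comp]

lemma frameOf_transition {J K : ChartIndex d e} {T : Scheme.{0}} (f : T ⟶ overlap M J K) :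
    SameSpan (frameOf M (f ≫ transition M J K ≫ overlapι M K J))
      (frameOf M (f ≫ overlapι M J K)) := by
  unfold transition
  rw [overlapMk_ι, frameOf_comp, frameOf_chartMk, frameOf_comp M f]
  have := (normalize_sameSpan K (frameOf M (𝟙 (overlap M J K) ≫ overlapι M J K))
    (isUnit_of_overlap M _)).map f.appTop.hom
  rwa [Category.id_comp] at this ⊢

/-- The change of charts on a triple intersection. -/
def tripleTransition (I J K : ChartIndex d e) :
    pullback (overlapι M I J) (overlapι M I K) ⟶ pullback (overlapι M J K) (overlapι M J I) :=
  pullback.lift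
    (overlapMk M J K
      (scalarOf M (pullback.fst (overlapι M I J) (overlapι M I K) ≫
        transition M I J ≫ overlapι M J I))
      (frameOf M (pullback.fst (overlapι M I J) (overlapι M I K) ≫
        transition M I J ≫ overlapι M J I))
      (isChartPoint_of M _)
      (isUnit_block (frameOf_transition M _) K fun i => by
        rw [pullback.condition]; exact isUnit_of_overlap M _ i))
    (pullback.fst (overlapι M I J) (overlapι M I K) ≫ transition M I J)
    (by
      rw [overlapMk_ι]
      apply chart_hom_ext
      · rw [scalarOf_chartMk, Category.assoc]
      · rw [frameOf_chartMk, Category.assoc]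
        exact ⟨fun _ => 1, fun _ => by simp⟩)

lemma tripleTransition_snd (I J K : ChartIndex d e) :
    tripleTransition M I J K ≫ pullback.snd _ _ = pullback.fst _ _ ≫ transition M I J :=
  pullback.lift_snd _ _ _

lemma tripleTransition_fst (I J K : ChartIndex d e) {T : Scheme.{0}}
    (g : T ⟶ pullback (overlapι M I J) (overlapι M I K)) :
    (g ≫ tripleTransition M I J K) ≫ pullback.fst _ _ ≫ overlapι M J K
      = (g ≫ pullback.fst _ _) ≫ transition M I J ≫ overlapι M J I := by
  rw [pullback.condition, Category.assoc, ← Category.assoc (tripleTransition M I J K),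
    tripleTransition_snd]
  simp only [Category.assoc]

/-- The gluing data of the quiver Grassmannian. -/
def glueData (e : V → ℕ) (M : RepSpace d) : Scheme.GlueData.{0} where
  J := ChartIndex d e
  U := chart M
  V := fun p => overlap M p.1 p.2
  f := overlapι M
  f_open := inferInstance
  f_id := fun J => by
    have h : IsUnit (overlapDet M J J) := by
      unfold overlapDet
      simp [(chartFrame_isChartPoint M J).normalized]
    have : IsIso (CommRingCat.ofHom
        (algebraMap (ChartRing M J) (Localization.Away (overlapDet M J J)))) :=
      (IsLocalization.atUnit (ChartRing M J) (Localization.Away (overlapDet M J J))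
        (overlapDet M J J) h).toRingEquiv.toCommRingCatIso.isIso_hom
    unfold overlapι
    infer_instance
  t := transition M
  t_id := fun J => by
    rw [← cancel_mono (overlapι M J J), Category.id_comp]
    apply chart_hom_ext
    · simpa using scalarOf_transition M (𝟙 (overlap M J J))
    · simpa using frameOf_transition M (𝟙 (overlap M J J))
  t' := tripleTransition M
  t_fac := tripleTransition_snd M
  cocycle := fun I J K => by
    rw [← cancel_mono (pullback.fst (overlapι M I J) (overlapι M I K)),
      ← cancel_mono (overlapι M I J), Category.id_comp]
    have e1 := tripleTransition_fst M K I J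
      (tripleTransition M I J K ≫ tripleTransition M J K I)
    have e2 := tripleTransition_fst M J K I (tripleTransition M I J K)
    have e3 := tripleTransition_fst M I J K (𝟙 _)
    simp only [Category.id_comp, Category.assoc] at e1 e2 e3
    simp only [Category.assoc]
    rw [e1]
    apply chart_hom_ext
    · have s1 := scalarOf_transition M (tripleTransition M I J K ≫ tripleTransition M J K I ≫
        pullback.fst (overlapι M K I) (overlapι M K J))
      have s2 := scalarOf_transition M (tripleTransition M I J K ≫
        pullback.fst (overlapι M J K) (overlapι M J I))
      have s3 := scalarOf_transition M (pullback.fst (overlapι M I J) (overlapι M I K))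
      simp only [Category.assoc] at s1 s2 s3
      rw [s1, e2, s2, e3, s3]
    · have s1 := frameOf_transition M (tripleTransition M I J K ≫ tripleTransition M J K I ≫
        pullback.fst (overlapι M K I) (overlapι M K J))
      have s2 := frameOf_transition M (tripleTransition M I J K ≫
        pullback.fst (overlapι M J K) (overlapι M J I))
      have s3 := frameOf_transition M (pullback.fst (overlapι M I J) (overlapι M I K))
      simp only [Category.assoc] at s1 s2 s3
      rw [e2] at s1
      rw [e3] at s2
      exact s1.trans (s2.trans s3)

/-- The quiver Grassmannian `Gr_e(M)`, as a scheme. -/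
def quiverGrassmannian (e : V → ℕ) (M : RepSpace d) : Scheme.{0} := (glueData e M).glued

/-- The structure morphism of a chart. -/
def chartStr (J : ChartIndex d e) : chart M J ⟶ Spec (CommRingCat.of ℂ) :=
  Spec.map (CommRingCat.ofHom (chartScalar M J))

lemma chartStr_eq {J K : ChartIndex d e} {T : Scheme.{0}} {f : T ⟶ chart M J} {g : T ⟶ chart M K}
    (h : scalarOf M f = scalarOf M g) : f ≫ chartStr M J = g ≫ chartStr M K := by
  have key : ∀ {L : ChartIndex d e} (k : T ⟶ chart M L),
      (Scheme.ΓSpecIso (CommRingCat.of ℂ)).inv ≫ (k ≫ chartStr M L).appTop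
        = CommRingCat.ofHom (scalarOf M k) := by
    intro L k
    rw [Scheme.Hom.comp_appTop]
    unfold chartStr
    rw [← Scheme.ΓSpecIso_inv_naturality_assoc]
    rfl
  apply ext_to_Spec
  exact (key f).trans ((congrArg CommRingCat.ofHom h).trans (key g).symm)

/-- The structure morphism of the quiver Grassmannian over the complex numbers. -/
def structureMap (e : V → ℕ) (M : RepSpace d) :
    quiverGrassmannian e M ⟶ Spec (CommRingCat.of ℂ) :=
  Multicoequalizer.desc (glueData e M).diagram _ (fun J => chartStr M J) (by
    rintro ⟨I, J⟩
    have h := scalarOf_transition M (𝟙 (overlap M I J))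
    rw [Category.id_comp, Category.id_comp] at h
    have h2 := (chartStr_eq M h).symm
    rw [Category.assoc] at h2
    exact h2.trans (Category.assoc _ _ _).symm)

end Chart

end QuiverGr

end

noncomputable section

/-! ### Krull dimension of smooth algebras over a field -/

/-! On the chart `J` the unknowns are the `∑ d i * e i` entries of the frames `F i`. The equations
are `∑ e i ^ 2` normalizations and, for each arrow `i ⟶ j`, `e i * (d j - e j)` incidence
conditions, those in the rows of `J j` being redundant. Unknowns minus equations is `⟨e, d - e⟩`, so
everything follows once the Jacobian of the equations is surjective at every point.

Rigidity provides this. A family `Y` of matrices, one per arrow, defines a self-extension of `M`; a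
splitting of it writes `Y` as a commutator `M a * T i - T j * M a` (`IsRigid.exists_commutator`). By
linearity the same holds over every ring under `ℂ`. To attain a prescribed value `W a` of the
differential, extend `W a` from the column span of `F i` to the whole space, write the extension as
a commutator, and move each `F i` in the direction `T i * F i`, corrected to respect the
normalization (`IsRigid.exists_stableDifferential_eq`). This is applied at the universal point of
the chart, hence covers all primes at once.

The Jacobian criterion then makes the charts locally standard smooth of relative dimension `⟨e, d -
e⟩`; an invertible minor of full size forces this number to be non-negative as soon as some chart
has a prime. A nonzero standard smooth algebra of relative dimension `n` over a field is étale over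
a polynomial ring in `n` variables, so it has Krull dimension `n`, and Krull dimension can be
computed on an open cover. -/

lemma Ideal.IsMaximal.under_of_finiteType (R : Type*) {S : Type*} [CommRing R] [CommRing S]
    [Algebra R S] [IsJacobsonRing R] [Algebra.FiniteType R S] (m : Ideal S) [hm : m.IsMaximal] :
    (m.under R).IsMaximal := by
  let := Ideal.Quotient.field m
  have : Algebra.FiniteType R (S ⧸ m) :=
    Algebra.FiniteType.of_surjective (Ideal.Quotient.mkₐ R m) (Ideal.Quotient.mkₐ_surjective R m)
  -- General Nullstellensatz: a field of finite type over a Jacobson ring is finite over it.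
  -- Integrality then lets the maximal ideal `⊥` of `S ⧸ m` contract to a maximal ideal.
  have : Module.Finite R (S ⧸ m) := finite_of_finite_type_of_isJacobsonRing R (S ⧸ m)
  have h := Ideal.isMaximal_comap_of_isIntegral_of_isMaximal (R := R) (⊥ : Ideal (S ⧸ m))
  convert h using 1
  ext x
  rw [Ideal.mem_comap, Ideal.mem_comap, Ideal.mem_bot, ← Ideal.Quotient.mk_algebraMap,
    Ideal.Quotient.eq_zero_iff_mem]

/-- Every maximal ideal of a polynomial ring in `n` variables over a field has height `n`. -/
lemma MvPolynomial.height_of_isMaximal {k : Type*} [Field k] (n : ℕ)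
    (m : Ideal (MvPolynomial (Fin n) k)) [hm : m.IsMaximal] : m.height = n := by
  induction n with
  | zero =>
    let e := (MvPolynomial.isEmptyRingEquiv k (Fin 0)).symm
    have := MulEquiv.isField (Field.toIsField k) e.symm.toMulEquiv
    let := this.toField
    rw [Ideal.eq_bot_of_prime m]
    simp
  | succ n ih =>
    let e := (MvPolynomial.finSuccEquiv k n).toRingEquiv
    have hm' : (m.comap e.symm).IsMaximal := Ideal.comap_isMaximal_of_equiv e.symm
    rw [← RingEquiv.height_comap e.symm m]
    generalize m.comap e.symm = P at hm'
    -- The contraction to `n` variables is again maximal, so induction gives it height `n`; the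
    -- remaining polynomial variable adds one.
    have := Ideal.IsMaximal.under_of_finiteType (MvPolynomial (Fin n) k) P
    rw [Polynomial.height_eq_height_add_one (P.under (MvPolynomial (Fin n) k)) P, ih]
    simp

/-- The algebra is étale over affine `n`-space. Quasi-finiteness bounds the dimension above by `n`;
going down, applied at one maximal ideal, bounds it below. -/
theorem Algebra.IsStandardSmoothOfRelativeDimension.ringKrullDim_eq (k A : Type*) [Field k]
    [CommRing A] [Algebra k A] [Nontrivial A] (n : ℕ)
    [Algebra.IsStandardSmoothOfRelativeDimension n k A] : ringKrullDim A = n := by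
  obtain ⟨g, hg⟩ := Algebra.IsStandardSmoothOfRelativeDimension.exists_etale_mvPolynomial n k A
  let : Algebra (MvPolynomial (Fin n) k) A := g.toRingHom.toAlgebra
  have hE : Algebra.Etale (MvPolynomial (Fin n) k) A := hg
  have hdim : ringKrullDim (MvPolynomial (Fin n) k) = n := by
    simp [MvPolynomial.ringKrullDim_of_isNoetherianRing, ringKrullDim_eq_zero_of_field]
  apply le_antisymm
  · rw [← hdim]
    refine Order.krullDim_le_of_strictMono
      (PrimeSpectrum.comap (algebraMap (MvPolynomial (Fin n) k) A)) fun P Q hPQ => ?_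
    -- There are no strict inclusions between primes in a fibre of a quasi-finite map, so
    -- contraction preserves strict chains.
    refine lt_of_le_of_ne (Ideal.comap_mono hPQ.le) fun h => hPQ.ne ?_
    exact PrimeSpectrum.ext (Algebra.QuasiFinite.eq_of_le_of_under_eq
      (R := MvPolynomial (Fin n) k) P.asIdeal Q.asIdeal hPQ.le (congrArg PrimeSpectrum.asIdeal h))
  · obtain ⟨m, hm⟩ := Ideal.exists_maximal A
    have hA : IsNoetherianRing A := Algebra.FiniteType.isNoetherianRing (MvPolynomial (Fin n) k) A
    have := Ideal.IsMaximal.under_of_finiteType (MvPolynomial (Fin n) k) m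
    have h := Ideal.height_eq_height_add_of_liesOver_of_hasGoingDown
      (m.under (MvPolynomial (Fin n) k)) m
    rw [MvPolynomial.height_of_isMaximal] at h
    have h2 : (n : ℕ∞) ≤ m.height := by rw [h]; exact le_self_add
    refine le_trans ?_ (Ideal.height_le_ringKrullDim_of_ne_top hm.ne_top)
    exact_mod_cast h2

/-! ### Krull dimension of a topological space is local -/

open TopologicalSpace Topology in
-- The dimension is the supremum of the coheights of irreducible closed sets `Z`. All closed sets
-- above `Z` meet any open set that meets `Z`, so each coheight can be computed inside one such open
-- set.
lemma topologicalKrullDim_eq_of_isOpenEmbedding {X : Type*} [TopologicalSpace X] [Nonempty X]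
    {n : WithBot ℕ∞} (h : ∀ x : X, ∃ (Y : Type) (_ : TopologicalSpace Y) (f : Y → X),
      IsOpenEmbedding f ∧ x ∈ Set.range f ∧ topologicalKrullDim Y = n) :
    topologicalKrullDim X = n := by
  apply le_antisymm
  · rw [topologicalKrullDim, Order.krullDim_eq_iSup_coheight]
    refine iSup_le fun Z => ?_
    obtain ⟨x, hx⟩ := Z.isIrreducible.nonempty
    obtain ⟨Y, _, f, hf, ⟨y, rfl⟩, hY⟩ := h x
    obtain ⟨W, hW⟩ := (IrreducibleCloseds.orderIsoOfIsOpenEmbedding f hf).surjective ⟨Z, ⟨y, hx⟩⟩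
    have hW' : IrreducibleCloseds.map f hf.continuous W = Z := congrArg Subtype.val hW
    rw [← hW', hf.coheight_map, ← hY]
    exact Order.coheight_le_krullDim W
  · obtain ⟨Y, _, f, hf, -, hY⟩ := h (Classical.arbitrary X)
    exact hY ▸ hf.isInducing.topologicalKrullDim_le

/-! ### Extensions and rigidity -/

/-- The obstruction to lifting the identity of `S.X₃` along `S.g` is its image under the connecting
map, which lies in a vanishing `Ext¹`. -/
lemma CategoryTheory.ShortComplex.ShortExact.exists_section {C : Type*} [Category C] [Abelian C]
    [HasExt C] {S : ShortComplex C} (hS : S.ShortExact)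
    (h : Subsingleton (Abelian.Ext S.X₃ S.X₁ 1)) : ∃ s : S.X₃ ⟶ S.X₂, s ≫ S.g = 𝟙 S.X₃ := by
  obtain ⟨x, hx⟩ := Abelian.Ext.covariant_sequence_exact₃ S.X₃ hS (Abelian.Ext.mk₀ (𝟙 S.X₃))
    (zero_add 1) (Subsingleton.elim _ _)
  obtain ⟨s, rfl⟩ := Abelian.Ext.homEquiv₀.symm.surjective x
  refine ⟨s, Abelian.Ext.homEquiv₀.symm.injective ?_⟩
  exact (Abelian.Ext.mk₀_comp_mk₀ s S.g).symm.trans hx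

/-- Homology, monomorphisms and epimorphisms in a functor category can be tested objectwise. -/
lemma CategoryTheory.ShortComplex.shortExact_of_evaluation {J D : Type*} [Category J] [Category D]
    [Abelian D] (S : ShortComplex (J ⥤ D))
    (h : ∀ x, (S.map ((evaluation J D).obj x)).ShortExact) : S.ShortExact where
  exact := by
    rw [ShortComplex.exact_iff_isZero_homology]
    refine Functor.isZero _ fun x => ?_
    refine IsZero.of_iso ?_ (S.mapHomologyIso ((evaluation J D).obj x)).symm
    rw [← ShortComplex.exact_iff_isZero_homology]
    exact (h x).exact
  mono_f := by
    have (x : J) : Mono (S.f.app x) := (h x).mono_f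
    exact NatTrans.mono_of_mono_app S.f
  epi_g := by
    have (x : J) : Epi (S.g.app x) := (h x).epi_g
    exact NatTrans.epi_of_epi_app S.g

/-- A natural transformation between representations of a quiver in a category. -/
def CategoryTheory.Paths.natTransOfArrows {V : Type*} [Quiver V] {C : Type*} [Category C]
    {φ ψ : V ⥤q C} (α : ∀ i, φ.obj i ⟶ ψ.obj i)
    (h : ∀ ⦃i j : V⦄ (a : i ⟶ j), φ.map a ≫ α j = α i ≫ ψ.map a) :
    Paths.lift φ ⟶ Paths.lift ψ where
  app := α
  naturality i j p₀ := by
    suffices H : ∀ p : Quiver.Path (V := V) i j,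
        (Paths.lift φ).map p ≫ α j = α i ≫ (Paths.lift ψ).map p from H p₀
    clear p₀
    intro p
    induction p with
    | nil => exact (Category.id_comp _).trans (Category.comp_id _).symm
    | cons p a ih =>
      refine (Category.assoc _ _ _).trans ?_
      refine (congrArg _ (h a)).trans ?_
      refine (Category.assoc _ _ _).symm.trans ?_
      refine (congrArg (fun x => x ≫ ψ.map a) ih).trans ?_
      exact Category.assoc _ _ _

namespace QuiverGr

variable {V : Type} [Quiver.{0} V] {d : V → ℕ}

/-- The self-extension of a representation given by a family of matrices. -/
def selfExtension (M Y : RepSpace d) : Rep V :=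
  Paths.lift
    { obj := fun i => FGModuleCat.of ℂ ((Fin (d i) → ℂ) × (Fin (d i) → ℂ))
      map := fun a => FGModuleCat.ofHom
        (((Matrix.toLin' (M a)).comp (LinearMap.fst ℂ _ _) +
          (Matrix.toLin' (Y a)).comp (LinearMap.snd ℂ _ _)).prod
          ((Matrix.toLin' (M a)).comp (LinearMap.snd ℂ _ _))) }

/-- The inclusion into a self-extension. -/
def selfExtensionInl (M Y : RepSpace d) : toRep M ⟶ selfExtension M Y :=
  Paths.natTransOfArrows (fun i => FGModuleCat.ofHom (LinearMap.inl ℂ _ _)) fun i j a => by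
    refine FGModuleCat.hom_ext (LinearMap.ext fun x => ?_)
    change ((Matrix.toLin' (M a) x, 0) : (Fin (d j) → ℂ) × (Fin (d j) → ℂ)) =
      (Matrix.toLin' (M a) x + Matrix.toLin' (Y a) 0, Matrix.toLin' (M a) 0)
    simp

/-- The projection from a self-extension. -/
def selfExtensionSnd (M Y : RepSpace d) : selfExtension M Y ⟶ toRep M :=
  Paths.natTransOfArrows (fun _ => FGModuleCat.ofHom (LinearMap.snd ℂ _ _)) fun _ _ _ =>
    FGModuleCat.hom_ext (LinearMap.snd_prod ..)

/-- The short exact sequence of a self-extension. -/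
def selfExtensionComplex (M Y : RepSpace d) : ShortComplex (Rep V) where
  f := selfExtensionInl M Y
  g := selfExtensionSnd M Y
  zero := NatTrans.ext (funext fun i => FGModuleCat.hom_ext
    (LinearMap.snd_comp_inl ℂ (Fin (d i) → ℂ) (Fin (d i) → ℂ)))

lemma selfExtensionComplex_shortExact (M Y : RepSpace d) :
    (selfExtensionComplex M Y).ShortExact := by
  refine ShortComplex.shortExact_of_evaluation _ fun i => ?_
  -- The product decomposition splits the sequence at each vertex; these splittings need not be
  -- compatible with the arrows.
  refine ShortComplex.Splitting.shortExact
    { r := FGModuleCat.ofHom (LinearMap.fst ℂ (Fin (d i) → ℂ) (Fin (d i) → ℂ))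
      s := FGModuleCat.ofHom (LinearMap.inr ℂ (Fin (d i) → ℂ) (Fin (d i) → ℂ))
      f_r := FGModuleCat.hom_ext (LinearMap.fst_comp_inl ℂ (Fin (d i) → ℂ) (Fin (d i) → ℂ))
      s_g := FGModuleCat.hom_ext (LinearMap.snd_comp_inr ℂ (Fin (d i) → ℂ) (Fin (d i) → ℂ))
      id := FGModuleCat.hom_ext ?_ }
  refine LinearMap.ext fun x => ?_
  exact Prod.fst_add_snd x

/-- `Ext¹(M, M)` is the obstruction to solving the commutator equation: a section of the
self-extension defined by `Y` has the form `v ↦ (f₁ v, v)`, and its compatibility with an arrow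
reads `f₁ M = M f₁ + Y`. -/
theorem IsRigid.exists_commutator {M : RepSpace d} (hM : IsRigid M) (Y : RepSpace d) :
    ∃ T : ∀ i, Matrix (Fin (d i)) (Fin (d i)) ℂ,
      ∀ ⦃i j : V⦄ (a : i ⟶ j), M a * T i - T j * M a = Y a := by
  have : HasExt (Rep V) := HasExt.standard (Rep V)
  obtain ⟨s, hs⟩ := (selfExtensionComplex_shortExact M Y).exists_section (by exact hM)
  let f : ∀ i, (Fin (d i) → ℂ) →ₗ[ℂ] (Fin (d i) → ℂ) × (Fin (d i) → ℂ) :=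
    fun i => (s.app i).hom.hom
  have hs' : ∀ i, (s ≫ (selfExtensionComplex M Y).g).app i = 𝟙 ((toRep M).obj i) := fun i =>
    congrArg (fun t => NatTrans.app t i) hs
  have hf : ∀ i v, (f i v).2 = v := by
    intro i v
    have := congrArg (fun t => t.hom.hom v) (hs' i)
    exact this
  have hnat : ∀ ⦃i j : V⦄ (a : i ⟶ j) v, (f j (Matrix.toLin' (M a) v)).1 =
      Matrix.toLin' (M a) (f i v).1 + Matrix.toLin' (Y a) (f i v).2 := by
    intro i j a v
    have h := s.naturality (X := i) (Y := j) a.toPath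
    have h1 : (toRep M).map a.toPath = FGModuleCat.ofHom (Matrix.toLin' (M a)) :=
      Paths.lift_toPath _ a
    have h2 : (selfExtension M Y).map a.toPath = _ := Paths.lift_toPath _ a
    have h3 := (congrArg (fun t => t ≫ s.app j) h1).symm.trans
      (h.trans (congrArg (fun t => s.app i ≫ t) h2))
    exact congrArg Prod.fst (congrArg (fun t => t.hom.hom v) h3)
  -- The sign turns `f₁ M - M f₁ = Y` into `M T - T M = Y` with `T = -f₁`.
  refine ⟨fun i => - LinearMap.toMatrix' ((LinearMap.fst ℂ _ _).comp (f i)), fun i j a => ?_⟩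
  apply Matrix.toLin'.injective
  refine LinearMap.ext fun v => ?_
  have := hnat a v
  rw [hf] at this
  simp only [Matrix.mul_neg, Matrix.neg_mul, sub_neg_eq_add, map_add, map_neg, Matrix.toLin'_mul,
    Matrix.toLin'_toMatrix', LinearMap.add_apply, LinearMap.neg_apply, LinearMap.comp_apply,
    LinearMap.fst_apply, this]
  abel

end QuiverGr

/-! ### The Jacobian criterion -/

/-- The columns span, so a basis can be selected among them; the selected columns form an invertible
square matrix. -/
lemma Matrix.exists_det_submatrix_ne_zero_of_mulVec_surjective {K m n : Type*} [Field K] [Fintype m]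
    [DecidableEq m] [Fintype n] (N : Matrix m n K) (hN : Function.Surjective N.mulVec) :
    ∃ a : m → n, Function.Injective a ∧ (N.submatrix id a).det ≠ 0 := by
  obtain ⟨κ, a, ha, hspan, hli⟩ := exists_linearIndependent' K N.col
  have htop : Submodule.span K (Set.range (N.col ∘ a)) = ⊤ := by
    rw [hspan, ← Matrix.range_mulVecLin]
    exact LinearMap.range_eq_top.mpr hN
  let b := Module.Basis.mk hli htop.ge
  let e : m ≃ κ := (Pi.basisFun K m).indexEquiv b
  refine ⟨a ∘ e, ha.comp e.injective, ?_⟩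
  rw [← isUnit_iff_ne_zero, ← Matrix.isUnit_iff_isUnit_det,
    ← Matrix.linearIndependent_cols_iff_isUnit]
  exact hli.comp e e.injective

lemma MvPolynomial.mkDerivation_eq_sum_pderiv {k ι A : Type*} [CommSemiring k] [Fintype ι]
    [AddCommMonoid A] [Module k A] [Module (MvPolynomial ι k) A]
    [IsScalarTower k (MvPolynomial ι k) A] (f : ι → A) (q : MvPolynomial ι k) :
    MvPolynomial.mkDerivation k f q = ∑ x, MvPolynomial.pderiv x q • f x := by
  classical
  let D : ι → Derivation k (MvPolynomial ι k) A := fun x =>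
    (LinearMap.toSpanSingleton (MvPolynomial ι k) A (f x)).compDer (MvPolynomial.pderiv x)
  have hD : ∀ q, (∑ x, D x) q = ∑ x, MvPolynomial.pderiv x q • f x := fun q =>
    (congrFun (map_sum Derivation.coeFnAddMonoidHom D Finset.univ) q).trans
      (Finset.sum_apply _ _ _)
  have h : MvPolynomial.mkDerivation k f = ∑ x, D x := by
    refine MvPolynomial.derivation_ext fun i => ?_
    simp [MvPolynomial.mkDerivation_X, hD, MvPolynomial.pderiv_X, Pi.single_apply, ite_smul]
  rw [h, hD]

/-- Jacobian criterion: if the Jacobian matrix of a family of polynomials defines a surjective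
linear map over the quotient by these polynomials, then the quotient is, locally at every prime,
standard smooth of the expected relative dimension. -/
theorem MvPolynomial.exists_isStandardSmoothOfRelativeDimension_away {k ι σ : Type} [CommRing k]
    [Fintype ι] [Fintype σ] (v : σ → MvPolynomial ι k) {I : Ideal (MvPolynomial ι k)}
    (hI : I = Ideal.span (Set.range v))
    (hv : ∀ y : σ → MvPolynomial ι k ⧸ I, ∃ X : ι → MvPolynomial ι k ⧸ I,
      ∀ r, MvPolynomial.mkDerivation k X (v r) = y r)
    (p : Ideal (MvPolynomial ι k ⧸ I)) [p.IsPrime] :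
    Fintype.card σ ≤ Fintype.card ι ∧ ∃ f ∉ p,
      Algebra.IsStandardSmoothOfRelativeDimension (Fintype.card ι - Fintype.card σ) k
        (Localization.Away f) := by
  classical
  subst hI
  set S := MvPolynomial ι k ⧸ Ideal.span (Set.range v)
  let N : Matrix σ ι S := Matrix.of fun r x => Ideal.Quotient.mk _ (MvPolynomial.pderiv x (v r))
  have hN : ∀ y : σ → S, ∃ X : ι → S, N.mulVec X = y := by
    intro y
    obtain ⟨X, hX⟩ := hv y
    refine ⟨X, ?_⟩
    ext r
    rw [← hX r, MvPolynomial.mkDerivation_eq_sum_pderiv]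
    rfl
  -- Surjectivity passes to the residue field: the images of preimages of the standard basis vectors
  -- suffice.
  have hK : Function.Surjective (N.map (algebraMap S p.ResidueField)).mulVec := by
    choose X hX using fun r => hN (Pi.single r 1)
    intro y
    refine ⟨∑ r, y r • (algebraMap S p.ResidueField ∘ X r), ?_⟩
    rw [Matrix.mulVec_sum]
    have h : ∀ r, (N.map (algebraMap S p.ResidueField)).mulVec
        (algebraMap S p.ResidueField ∘ X r) = Pi.single r 1 := by
      intro r
      ext r'
      rw [← RingHom.map_mulVec, hX, Pi.single_apply, Pi.single_apply]
      split_ifs <;> simp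
    simp only [Matrix.mulVec_smul, h]
    ext r
    simp [Finset.sum_apply, Pi.single_apply]
  obtain ⟨a, ha, hdet⟩ := Matrix.exists_det_submatrix_ne_zero_of_mulVec_surjective _ hK
  -- The presentation by the relations `v`, with `a` selecting the variables of the nonvanishing
  -- minor. Its Jacobian is that minor, and inverting it gives the required localization.
  let P := Algebra.PreSubmersivePresentation.naive (v := v) a ha
  have hP : algebraMap S p.ResidueField P.jacobian ≠ 0 := by
    rw [P.jacobian_eq_jacobiMatrix_det, ← RingHom.comp_apply, RingHom.map_det,
      ← Matrix.det_transpose]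
    refine (congrArg Matrix.det ?_).trans_ne hdet
    ext i j
    exact congrArg (fun q => algebraMap S p.ResidueField (Ideal.Quotient.mk _ q))
      (Algebra.PreSubmersivePresentation.jacobiMatrix_naive ..)
  refine ⟨Fintype.card_le_of_injective a ha, P.jacobian, fun h => hP ?_, ?_⟩
  · exact Ideal.algebraMap_residueField_eq_zero.mpr h
  · let Q := Algebra.SubmersivePresentation.localizationAway
      (Localization.Away P.jacobian) P.jacobian
    refine Algebra.SubmersivePresentation.isStandardSmoothOfRelativeDimension
      (P := { toPreSubmersivePresentation := Q.toPreSubmersivePresentation.comp P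
              jacobian_isUnit := ?_ }) ?_
    · rw [Algebra.PreSubmersivePresentation.comp_jacobian_eq_jacobian_smul_jacobian,
        Algebra.smul_def]
      exact (IsLocalization.Away.algebraMap_isUnit P.jacobian).mul Q.jacobian_isUnit
    · refine
        (Algebra.PreSubmersivePresentation.dimension_comp_eq_dimension_add_dimension _ _).trans ?_
      -- Localizing adds one variable and one relation, leaving the relative dimension unchanged.
      have h0 : Q.dimension = 0 := Algebra.Presentation.localizationAway_dimension_zero _
      rw [h0, zero_add]
      simp [Algebra.Presentation.dimension]

/-! ### The differential of the incidence equations -/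

namespace QuiverGr

variable {V : Type} [Quiver.{0} V] {d e : V → ℕ}

/-- The commutator map of a rigid representation is surjective after any extension of scalars. -/
theorem IsRigid.exists_commutator_arrowMat [Fintype V] [∀ i j : V, Fintype (i ⟶ j)]
    {M : RepSpace d} (hM : IsRigid M) {A : Type} [CommRing A] (φ : ℂ →+* A)
    (Y : ∀ ⦃i j : V⦄, (i ⟶ j) → Matrix (Fin (d j)) (Fin (d i)) A) :
    ∃ T : ∀ i, Matrix (Fin (d i)) (Fin (d i)) A,
      ∀ ⦃i j : V⦄ (a : i ⟶ j), arrowMat M φ a * T i - T j * arrowMat M φ a = Y a := by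
  classical
  let ι := Σ i : V, Σ j : V, (i ⟶ j) × Fin (d j) × Fin (d i)
  -- The elementary families form a basis of the space of families over `ℂ`. Since the commutator is
  -- linear, solutions for them combine with the entries of `Y` as coefficients.
  let E : ι → RepSpace d := fun x i j a => Matrix.of fun r c =>
    if (⟨i, j, a, r, c⟩ : ι) = x then 1 else 0
  choose T hT using fun x => hM.exists_commutator (E x)
  refine ⟨fun i => ∑ x : ι, Y x.2.2.1 x.2.2.2.1 x.2.2.2.2 • (T x i).map φ, fun i j a => ?_⟩
  have h : ∀ x, arrowMat M φ a * (T x i).map φ - (T x j).map φ * arrowMat M φ a =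
      (E x a).map φ := by
    intro x
    rw [← hT x a, Matrix.map_sub φ (map_sub φ), Matrix.map_mul, Matrix.map_mul]
    rfl
  rw [Matrix.mul_sum, Matrix.sum_mul, ← Finset.sum_sub_distrib]
  simp only [Matrix.mul_smul, Matrix.smul_mul, ← smul_sub, h]
  ext r c
  simp only [Matrix.sum_apply, Matrix.smul_apply, Matrix.map_apply, E, Matrix.of_apply, smul_eq_mul]
  rw [Finset.sum_eq_single (⟨i, j, a, r, c⟩ : ι)]
  · simp
  · intro x _ hx
    rw [if_neg hx.symm, map_zero, mul_zero]
  · intro hx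
    exact absurd (Finset.mem_univ _) hx

/-- The differential of the equation `IsChartPoint.stable` at the point `F`, in the
direction `X`. -/
def stableDifferential (M : RepSpace d) (J : ChartIndex d e) {A : Type} [CommRing A]
    (φ : ℂ →+* A) (F X : Frames d e A) {i j : V} (a : i ⟶ j) : Matrix (Fin (d j)) (Fin (e i)) A :=
  arrowMat M φ a * X i - (X j * (arrowMat M φ a * F i).submatrix (J j) id +
    F j * (arrowMat M φ a * X i).submatrix (J j) id)

/-- At a point of a chart of the quiver Grassmannian of a rigid representation, the differential
of the equations is surjective. -/
theorem IsRigid.exists_stableDifferential_eq [Fintype V] [∀ i j : V, Fintype (i ⟶ j)]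
    {M : RepSpace d} (hM : IsRigid M) {J : ChartIndex d e} {A : Type} [CommRing A] {φ : ℂ →+* A}
    {F : Frames d e A} (hF : IsChartPoint M J φ F)
    (Z : ∀ i, Matrix (Fin (e i)) (Fin (e i)) A)
    (W : ∀ ⦃i j : V⦄, (i ⟶ j) → Matrix (Fin (d j)) (Fin (e i)) A)
    (hW : ∀ ⦃i j : V⦄ (a : i ⟶ j), (W a).submatrix (J j) id = 0) :
    ∃ X : Frames d e A, (∀ i, block J X i = Z i) ∧
      ∀ ⦃i j : V⦄ (a : i ⟶ j), stableDifferential M J φ F X a =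
        W a - F j * Z j * (arrowMat M φ a * F i).submatrix (J j) id := by
  -- `P i` selects the rows in `J i`. It is a left inverse of `F i`, so `W a * P i` below extends `W
  -- a` to the whole space: multiplying it by `F i` gives back `W a`.
  let P : ∀ i, Matrix (Fin (e i)) (Fin (d i)) A := fun i =>
    (1 : Matrix (Fin (d i)) (Fin (d i)) A).submatrix (J i) id
  have hP : ∀ {i : V} {n : ℕ} (N : Matrix (Fin (d i)) (Fin n) A),
      N.submatrix (J i) id = P i * N := by
    intro i n N
    have : ((1 : Matrix (Fin (d i)) (Fin (d i)) A) * N).submatrix (J i) id = P i * N := rfl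
    rwa [Matrix.one_mul] at this
  have hPF : ∀ i, P i * F i = 1 := fun i => (hP (F i)).symm.trans (hF.normalized i)
  obtain ⟨T, hT⟩ := hM.exists_commutator_arrowMat φ fun i _ a => W a * P i
  -- The motion of `F` under `T`, projected by `1 - F i * P i` so that its block vanishes, plus a
  -- term with block `Z i`. As `(1 - F j * P j) * M a * F i = 0`, the last term enters the
  -- differential only through `X j`, as `-F j * Z j * C`.
  let X : Frames d e A := fun i => T i * F i - F i * (P i * (T i * F i)) + F i * Z i
  refine ⟨X, fun i => ?_, fun i j a => ?_⟩
  · refine (hP (X i)).trans ?_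
    simp only [X, Matrix.mul_add, Matrix.mul_sub]
    rw [← Matrix.mul_assoc (P i) (F i), ← Matrix.mul_assoc (P i) (F i), hPF]
    simp
  · have hW' : P j * W a = 0 := (hP _).symm.trans (hW a)
    have hs := hF.stable a
    have hTF := congrArg (fun N => N * F i) (hT a)
    simp only [stableDifferential, hP] at hs ⊢
    generalize hC : P j * (arrowMat M φ a * F i) = C at hs ⊢
    simp only [Matrix.sub_mul, Matrix.mul_assoc, hs, hPF, Matrix.mul_one] at hTF
    have hMX : arrowMat M φ a * X i = arrowMat M φ a * (T i * F i) -
        F j * (C * (P i * (T i * F i))) + F j * (C * Z i) := by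
      simp only [X, Matrix.mul_add, Matrix.mul_sub]
      rw [← Matrix.mul_assoc _ (F i), ← Matrix.mul_assoc _ (F i), hs]
      simp only [Matrix.mul_assoc]
    have hMT : arrowMat M φ a * (T i * F i) = W a + T j * (F j * C) := by rw [← hTF]; abel
    rw [hMX, hMT]
    simp only [X, Matrix.mul_add, Matrix.mul_sub, Matrix.add_mul, Matrix.sub_mul, hW',
      Matrix.mul_zero, Matrix.mul_assoc]
    simp only [← Matrix.mul_assoc (P j) (F j), hPF, Matrix.one_mul]
    abel

end QuiverGr

/-! ### The Jacobian of the chart equations -/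

lemma Derivation.map_matrix_mul_apply {k R S : Type*} [CommRing k] [CommRing R] [CommRing S]
    [Algebra k R] [Algebra k S] [Algebra R S] (D : Derivation k R S)
    {l m n : Type*} [Fintype m] (A : Matrix l m R) (B : Matrix m n R) :
    (A * B).map D = A.map D * B.map (algebraMap R S) + A.map (algebraMap R S) * B.map D := by
  ext p q
  simp only [Matrix.map_apply, Matrix.mul_apply, Matrix.add_apply, map_sum, Derivation.leibniz,
    Algebra.smul_def, ← Finset.sum_add_distrib]
  refine Finset.sum_congr rfl fun x _ => ?_
  ring

namespace QuiverGr

variable {V : Type} [Quiver.{0} V] {d e : V → ℕ}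

/-- The index type of a non-redundant family of equations for a chart. -/
abbrev ChartEquation (J : ChartIndex d e) : Type :=
  (Σ i, Fin (e i) × Fin (e i)) ⊕
    (Σ i, Σ j, (i ⟶ j) × {p : Fin (d j) // p ∉ Set.range (J j)} × Fin (e i))

/-- A non-redundant family of equations for a chart. -/
def chartEquation (M : RepSpace d) (J : ChartIndex d e) : ChartEquation J → EntryRing d e
  | .inl ⟨i, p, q⟩ => block J (genericFrame d e) i p q -
      (1 : Matrix (Fin (e i)) (Fin (e i)) (EntryRing d e)) p q
  | .inr ⟨i, j, a, p, q⟩ => (arrowMat M (polyScalar d e) a * genericFrame d e i) p q -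
      (genericFrame d e j *
        (arrowMat M (polyScalar d e) a * genericFrame d e i).submatrix (J j) id) p q

/-- In a row belonging to `J j`, the incidence equation compares `N` with `block * N`, so it is a
combination of the normalization equations. Dropping these rows makes the number of equations equal
to the expected codimension. -/
lemma chartIdeal_eq_span_range (M : RepSpace d) (J : ChartIndex d e) :
    chartIdeal M J = Ideal.span (Set.range (chartEquation M J)) := by
  apply le_antisymm <;> refine Ideal.span_le.mpr ?_
  · have h1 : ∀ i p q, block J (genericFrame d e) i p q -
        (1 : Matrix (Fin (e i)) (Fin (e i)) (EntryRing d e)) p q ∈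
        Ideal.span (Set.range (chartEquation M J)) := fun i p q =>
      Ideal.subset_span ⟨.inl ⟨i, p, q⟩, rfl⟩
    rintro _ (⟨i, p, q, rfl⟩ | ⟨i, j, a, p, q, rfl⟩)
    · exact h1 i p q
    · by_cases hp : p ∈ Set.range (J j)
      · obtain ⟨p, rfl⟩ := hp
        generalize arrowMat M (polyScalar d e) a * genericFrame d e i = N
        have h2 : N (J j p) q = ∑ s, (1 : Matrix (Fin (e j)) (Fin (e j)) (EntryRing d e)) p s *
            N (J j s) q := by
          simp [Matrix.one_apply]
        rw [SetLike.mem_coe, h2, Matrix.mul_apply, ← Finset.sum_sub_distrib]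
        refine Ideal.sum_mem _ fun s _ => ?_
        rw [Matrix.submatrix_apply, id, ← sub_mul, ← neg_sub, neg_mul]
        exact neg_mem (Ideal.mul_mem_right _ _ (h1 j p s))
      · exact Ideal.subset_span ⟨.inr ⟨i, j, a, ⟨p, hp⟩, q⟩, rfl⟩
  · rintro _ ⟨⟨i, p, q⟩ | ⟨i, j, a, p, q⟩, rfl⟩
    · exact Ideal.subset_span (Or.inl ⟨i, p, q, rfl⟩)
    · exact Ideal.subset_span (Or.inr ⟨i, j, a, p, q, rfl⟩)

section Derivation

variable (M : RepSpace d) (J : ChartIndex d e) (X : Frames d e (ChartRing M J))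

/-- The derivation with values in the coordinate ring of a chart given by a tangent vector. -/
abbrev frameDerivation : Derivation ℂ (EntryRing d e) (ChartRing M J) :=
  MvPolynomial.mkDerivation ℂ fun x : Entry d e => X x.1 x.2.1 x.2.2

lemma genericFrame_map_frameDerivation (i : V) :
    (genericFrame d e i).map (frameDerivation M J X) = X i := by
  ext p q
  exact MvPolynomial.mkDerivation_X _ _ _

lemma frameDerivation_chartEquation_inl (i : V) (p q : Fin (e i)) :
    frameDerivation M J X (chartEquation M J (.inl ⟨i, p, q⟩)) = block J X i p q := by
  have h : frameDerivation M J X ((1 : Matrix (Fin (e i)) (Fin (e i)) (EntryRing d e)) p q) = 0 := by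
    by_cases hpq : p = q
    · subst hpq; simp
    · simp [Matrix.one_apply_ne hpq]
  refine (map_sub (frameDerivation M J X) _ _).trans ?_
  rw [h, sub_zero]
  exact congrFun (congrFun (genericFrame_map_frameDerivation M J X i) _) _

lemma frameDerivation_chartEquation_inr {i j : V} (a : i ⟶ j)
    (p : {p : Fin (d j) // p ∉ Set.range (J j)}) (q : Fin (e i)) :
    frameDerivation M J X (chartEquation M J (.inr ⟨i, j, a, p, q⟩)) =
      stableDifferential M J (chartScalar M J) (chartFrame M J) X a p q := by
  have hM : (arrowMat M (polyScalar d e) a).map (frameDerivation M J X) = 0 := by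
    ext r c
    exact MvPolynomial.derivation_C (frameDerivation M J X) _
  have hMF : (arrowMat M (polyScalar d e) a * genericFrame d e i).map (frameDerivation M J X) =
      arrowMat M (chartScalar M J) a * X i := by
    rw [Derivation.map_matrix_mul_apply, hM, Matrix.zero_mul, zero_add,
      genericFrame_map_frameDerivation]
    rfl
  have hmk : (arrowMat M (polyScalar d e) a * genericFrame d e i).map
      (algebraMap (EntryRing d e) (ChartRing M J)) =
      arrowMat M (chartScalar M J) a * chartFrame M J i :=
    Matrix.map_mul
  have h2 : (genericFrame d e j * (arrowMat M (polyScalar d e) a *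
      genericFrame d e i).submatrix (J j) id).map (frameDerivation M J X) =
      X j * (arrowMat M (chartScalar M J) a * chartFrame M J i).submatrix (J j) id +
      chartFrame M J j * (arrowMat M (chartScalar M J) a * X i).submatrix (J j) id := by
    rw [Derivation.map_matrix_mul_apply, genericFrame_map_frameDerivation, ← Matrix.submatrix_map,
      ← Matrix.submatrix_map, hMF, hmk]
    rfl
  refine (map_sub (frameDerivation M J X) _ _).trans ?_
  exact congrArg₂ (· - ·) (congrFun (congrFun hMF p) q) (congrFun (congrFun h2 p) q)

end Derivation

variable [Fintype V] [∀ i j : V, Fintype (i ⟶ j)]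

/-- The hypothesis of the Jacobian criterion, obtained from `IsRigid.exists_stableDifferential_eq`
at the universal point of the chart. -/
theorem IsRigid.exists_frameDerivation_eq {M : RepSpace d} (hM : IsRigid M) (J : ChartIndex d e)
    (y : ChartEquation J → ChartRing M J) :
    ∃ X : Frames d e (ChartRing M J), ∀ r, frameDerivation M J X (chartEquation M J r) = y r := by
  classical
  let Z : ∀ i, Matrix (Fin (e i)) (Fin (e i)) (ChartRing M J) := fun i =>
    Matrix.of fun p q => y (.inl ⟨i, p, q⟩)
  -- The added product cancels the contribution of `Z` to the differential; the rows in `J j` are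
  -- zero, as required, and carry no equation.
  let W : ∀ ⦃i j : V⦄, (i ⟶ j) → Matrix (Fin (d j)) (Fin (e i)) (ChartRing M J) := fun i j a =>
    Matrix.of fun p q => if hp : p ∉ Set.range (J j) then y (.inr ⟨i, j, a, ⟨p, hp⟩, q⟩) +
      (chartFrame M J j * Z j *
        (arrowMat M (chartScalar M J) a * chartFrame M J i).submatrix (J j) id) p q else 0
  obtain ⟨X, hX1, hX2⟩ := hM.exists_stableDifferential_eq (chartFrame_isChartPoint M J) Z W
    (fun i j a => by ext p q; simp [W])
  refine ⟨X, ?_⟩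
  rintro (⟨i, p, q⟩ | ⟨i, j, a, p, q⟩)
  · rw [frameDerivation_chartEquation_inl, hX1]
    rfl
  · rw [frameDerivation_chartEquation_inr, hX2, Matrix.sub_apply]
    simp only [W, Matrix.of_apply]
    rw [dif_pos p.2, add_sub_cancel_right]

open Classical in
-- Since `J j` has `e j` elements, the count is `∑ d i * e i - ∑ e i ^ 2 - ∑ e i * (d j - e j)`, the
-- last sum running over the arrows.
lemma card_entry_sub_card_chartEquation (J : ChartIndex d e) :
    (Fintype.card (Entry d e) : ℤ) - Fintype.card (ChartEquation J) =
      eulerForm (fun i => (e i : ℤ)) (fun i => (d i : ℤ) - (e i : ℤ)) := by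
  have h : ∀ j, (Fintype.card {p : Fin (d j) // p ∉ Set.range (J j)} : ℤ) = d j - e j := by
    intro j
    have := Fintype.card_subtype_compl (fun p : Fin (d j) => p ∈ Set.range (J j))
    have h2 : Fintype.card {p : Fin (d j) // p ∈ Set.range (J j)} = e j := by
      exact (Set.card_range_of_injective (J j).injective).trans (Fintype.card_fin _)
    have h3 : e j ≤ d j := by simpa using Fintype.card_le_of_injective _ (J j).injective
    rw [this, h2, Fintype.card_fin, Nat.cast_sub h3]
  simp only [Fintype.card_sum, Fintype.card_sigma, Fintype.card_prod, Fintype.card_fin,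
    Nat.cast_add, Nat.cast_sum, Nat.cast_mul, h, eulerForm, Finset.sum_const, Finset.card_univ,
    nsmul_eq_mul]
  rw [← sub_sub, ← Finset.sum_sub_distrib]
  congr 1
  · exact Finset.sum_congr rfl fun i _ => by ring
  · exact Finset.sum_congr rfl fun i _ => Finset.sum_congr rfl fun j _ => by ring

/-- The charts of the quiver Grassmannian of a rigid representation are smooth of the expected
relative dimension. -/
theorem IsRigid.exists_isStandardSmoothOfRelativeDimension_away {M : RepSpace d} (hM : IsRigid M)
    (J : ChartIndex d e) (p : Ideal (ChartRing M J)) [p.IsPrime] :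
    ∃ n : ℕ, (n : ℤ) = eulerForm (fun i => (e i : ℤ)) (fun i => (d i : ℤ) - (e i : ℤ)) ∧
      ∃ f ∉ p, Algebra.IsStandardSmoothOfRelativeDimension n ℂ (Localization.Away f) := by
  classical
  obtain ⟨hle, f, hf, h⟩ := MvPolynomial.exists_isStandardSmoothOfRelativeDimension_away
    (chartEquation M J) (chartIdeal_eq_span_range M J)
    (fun y => by
      obtain ⟨X, hX⟩ := hM.exists_frameDerivation_eq J y
      exact ⟨fun x => X x.1 x.2.1 x.2.2, hX⟩) p
  refine ⟨_, ?_, f, hf, h⟩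
  rw [Nat.cast_sub hle, card_entry_sub_card_chartEquation]

/-! ### Smoothness and dimension of the quiver Grassmannian -/

/-- The open immersion of a chart into the quiver Grassmannian. -/
abbrev chartι (M : RepSpace d) (J : ChartIndex d e) : chart M J ⟶ quiverGrassmannian e M :=
  (glueData e M).ι J

omit [∀ i j : V, Fintype (i ⟶ j)] in
lemma chartι_structureMap (M : RepSpace d) (J : ChartIndex d e) :
    chartι M J ≫ structureMap e M = chartStr M J :=
  Multicoequalizer.π_desc _ _ _ _ _

theorem IsRigid.smoothOfRelativeDimension_structureMap {M : RepSpace d} (hM : IsRigid M) {n : ℕ}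
    (hn : (n : ℤ) = eulerForm (fun i => (e i : ℤ)) (fun i => (d i : ℤ) - (e i : ℤ))) :
    SmoothOfRelativeDimension n (structureMap e M) := by
  have : IsZariskiLocalAtSource (@SmoothOfRelativeDimension.{0} n) :=
    HasRingHomProperty.instIsZariskiLocalAtSource (P := @SmoothOfRelativeDimension.{0} n)
  refine (IsZariskiLocalAtSource.iff_of_openCover (P := @SmoothOfRelativeDimension n)
    (X := quiverGrassmannian e M) (glueData e M).openCover).mpr fun (J : ChartIndex d e) => ?_
  refine (congrArg (SmoothOfRelativeDimension n) (chartι_structureMap M J)).mpr ?_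
  unfold chartStr
  rw [HasRingHomProperty.Spec_iff (P := @SmoothOfRelativeDimension n)]
  refine ⟨{f | Algebra.IsStandardSmoothOfRelativeDimension n ℂ (Localization.Away f)}, ?_, ?_⟩
  -- If the good elements did not generate the unit ideal, they would all lie in one maximal ideal,
  -- yet some good element avoids it.
  · by_contra h
    obtain ⟨m, hm, hle⟩ := Ideal.exists_le_maximal _ h
    obtain ⟨n', hn', f, hf, hs⟩ := hM.exists_isStandardSmoothOfRelativeDimension_away J m
    obtain rfl : n' = n := by exact_mod_cast hn'.trans hn.symm
    exact hf (hle (Ideal.subset_span hs))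
  · intro f hf
    have := (RingHom.isStandardSmoothOfRelativeDimension_algebraMap n).mpr
      (show Algebra.IsStandardSmoothOfRelativeDimension n ℂ (Localization.Away f) from hf)
    exact this

theorem IsRigid.topologicalKrullDim_quiverGrassmannian {M : RepSpace d} (hM : IsRigid M) {n : ℕ}
    (hn : (n : ℤ) = eulerForm (fun i => (e i : ℤ)) (fun i => (d i : ℤ) - (e i : ℤ)))
    [Nonempty (quiverGrassmannian e M)] :
    topologicalKrullDim (quiverGrassmannian e M) = n := by
  refine topologicalKrullDim_eq_of_isOpenEmbedding fun x => ?_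
  -- Every point has a standard smooth affine open neighbourhood, a basic open set of a chart, whose
  -- dimension is already known.
  obtain ⟨J, (y : PrimeSpectrum (ChartRing M J)), rfl⟩ := (glueData e M).ι_jointly_surjective x
  obtain ⟨n', hn', f, hf, hs⟩ := hM.exists_isStandardSmoothOfRelativeDimension_away J y.asIdeal
  obtain rfl : n' = n := by exact_mod_cast hn'.trans hn.symm
  let g : Spec (CommRingCat.of (Localization.Away f)) ⟶ chart M J :=
    Spec.map (CommRingCat.ofHom (algebraMap (ChartRing M J) (Localization.Away f)))
  have hg : IsOpenImmersion g := IsOpenImmersion.of_isLocalization f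
  have hι : IsOpenImmersion (chartι M J) :=
    inferInstanceAs (IsOpenImmersion ((glueData e M).ι J))
  have hy : y ∈ Set.range
      (PrimeSpectrum.comap (algebraMap (ChartRing M J) (Localization.Away f))) := by
    rw [PrimeSpectrum.localization_away_comap_range (Localization.Away f) f]
    exact hf
  obtain ⟨z, hz⟩ := hy
  have : Nontrivial (Localization.Away f) := z.nontrivial
  refine ⟨PrimeSpectrum (Localization.Away f), inferInstance, (g ≫ chartι M J),
    (g ≫ chartι M J).isOpenEmbedding, ⟨z, ?_⟩, ?_⟩
  · exact congrArg (chartι M J) hz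
  · rw [PrimeSpectrum.topologicalKrullDim_eq_ringKrullDim]
    exact Algebra.IsStandardSmoothOfRelativeDimension.ringKrullDim_eq ℂ _ n'

end QuiverGr

end

theorem mainTheorem1 {V : Type} [Quiver.{0} V] [Fintype V] [∀ i j : V, Fintype (i ⟶ j)]
    (d e : V → ℕ) (M : QuiverGr.RepSpace d) (hM : QuiverGr.IsRigid M)
    (hne : Nonempty (QuiverGr.quiverGrassmannian e M)) :
    ∃ n : ℕ,
      (n : ℤ) = QuiverGr.eulerForm (fun i => (e i : ℤ)) (fun i => (d i : ℤ) - (e i : ℤ)) ∧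
      SmoothOfRelativeDimension n (QuiverGr.structureMap e M) ∧
      topologicalKrullDim (QuiverGr.quiverGrassmannian e M) = n := by
  -- A point lies in some chart, and the Jacobian criterion at its prime shows that the Euler form
  -- is a natural number.
  obtain ⟨J, (y : PrimeSpectrum (QuiverGr.ChartRing M J)), -⟩ :=
    (QuiverGr.glueData e M).ι_jointly_surjective hne.some
  obtain ⟨n, hn, -⟩ := hM.exists_isStandardSmoothOfRelativeDimension_away J y.asIdeal
  exact ⟨n, hn, hM.smoothOfRelativeDimension_structureMap hn,
    hM.topologicalKrullDim_quiverGrassmannian hn⟩
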